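/- Let $(\mathcal X,d)$ be a complete separable metric space and $\mu$ a Borel probability measure on $\mathcal X$ whose support is all of $\mathcal X$. Let $(X_n)_{n\ge 1}$ and $(X_n')_{n\ge 1}$ be two independent sequences of independent random variables with law $\mu$. For $x_1,\dots,x_p\in\mathcal X$ write $d(x_1,\dots,x_p)=(d(x_i,x_j))_{1\le i<j\le p}\in\mathbb R^{\binom p2}$; for $x\in\mathcal X$ let $\nu^x$ be the law of the infinite distance matrix $(d(Z_i,Z_j))_{0\le i<j}$ with $Z_0=x$ and $Z_n=X_n$ for $n\ge1$, a probability measure on the space $\mathbb R^{\mathrm{met}}$ of real arrays $(d_{i,j})_{i<j}$ with $d_{i,k}\le d_{i,j}+d_{j,k}$ for all $i<j<k$, endowed with the product $\sigma$-algebra. Let $\mathrm{Isomp}(\mathcal X,d,\mu)$ be the group of bijective isometries $i:\mathcal X\to\mathcal X$ with $i_*\mu=\mu$. Then the following assertions are equivalent: 1. For all $p\ge 1$ and all bounded continuous $\varphi:\mathbb R^{\binom p2}\to\mathbb R$, $$\mathrm{cov}\big(\varphi(d(X_1,X_2,\dots,X_p)),\ \varphi(d(X_1,X_2',\dots,X_p'))\big)=0.$$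 2. The map $x\mapsto\nu^x$ is constant on $\mathcal X$. 3. The action of $\mathrm{Isomp}(\mathcal X,d,\mu)$ on $\mathcal X$ is transitive. 4. There exist a compact Hausdorff topological group $G$, a closed subgroup $K$ of $G$, a distance $d_{G/K}$ on the space $G/K$ of left cosets that induces the quotient topology and is $G$-invariant, i.e. $d_{G/K}(gg_1K,gg_2K)=d_{G/K}(g_1K,g_2K)$ for all $g,g_1,g_2\in G$, and a bijective isometry $\psi:(\mathcal X,d)\to(G/K,d_{G/K})$ such that $\psi_*\mu=\pi_*\mathrm{Haar}_G$, where $\mathrm{Haar}_G$ is the Haar probability measure of $G$ and $\pi:G\to G/K$ is the canonical projection. -/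

import Mathlib

open MeasureTheory ProbabilityTheory TopologicalSpace

universe u

/-- The coordinates `(i, j)`, `i < j`, of a `p × p` distance matrix, so that
`DistIndex p → ℝ` is `ℝ^(p choose 2)`. -/
abbrev DistIndex (p : ℕ) : Type := {ij : Fin p × Fin p // ij.1 < ij.2}

/-- The vector `d(x₁, …, x_p) = (d(x_i, x_j))_{i < j}`. -/
def distVector {X : Type u} [MetricSpace X] {p : ℕ} (x : Fin p → X) : DistIndex p → ℝ :=
  fun ij => dist (x ij.1.1) (x ij.1.2)

/-- The space `ℝ^met` of infinite distance matrices `(d_{i,j})_{i < j}` satisfying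
`d_{i,k} ≤ d_{i,j} + d_{j,k}` for `i < j < k`, with the product σ-algebra. -/
abbrev RMet : Type :=
  {D : {ij : ℕ × ℕ // ij.1 < ij.2} → ℝ //
    ∀ (i j k : ℕ) (hij : i < j) (hjk : j < k),
      D ⟨(i, k), hij.trans hjk⟩ ≤ D ⟨(i, j), hij⟩ + D ⟨(j, k), hjk⟩}

/-- The map `(x_n)_n ↦ (d(x_i, x_j))_{i < j}`. -/
def distMatrix {X : Type u} [MetricSpace X] (x : ℕ → X) : RMet :=
  ⟨fun ij => dist (x ij.1.1) (x ij.1.2), fun _ _ _ _ _ => dist_triangle _ _ _⟩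

/-- The map `S^x : (x₀, x₁, …) ↦ (x, x₀, x₁, …)`. -/
def prependPoint {X : Type u} (x : X) (s : ℕ → X) : ℕ → X :=
  fun n => Nat.casesOn n x s

/-- The pointed distance matrix distribution `ν^x`: the law of the distance matrix of
`(x, X₀, X₁, …)` where the `X_n` are independent with law `μ`. -/
noncomputable def pointedDistMatrixLaw {X : Type u} [MetricSpace X] [MeasurableSpace X]
    (μ : Measure X) [IsProbabilityMeasure μ] (x : X) : Measure RMet :=
  (Measure.infinitePi (fun _ : ℕ => μ)).map (fun s => distMatrix (prependPoint x s))

/-- The group `Isomp` of measure-preserving (bijective) isometries of `X`. -/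
def Isomp {X : Type u} [MetricSpace X] [MeasurableSpace X] [BorelSpace X] (μ : Measure X) :
    Subgroup (X ≃ᵢ X) where
  carrier := {i | μ.map i = μ}
  one_mem' := Measure.map_id
  mul_mem' := by
    intro a b ha hb
    have h : μ.map (⇑a ∘ ⇑b) = μ := by
      rw [← Measure.map_map a.continuous.measurable b.continuous.measurable, hb, ha]
    exact h
  inv_mem' := by
    intro a ha
    have h1 : μ.map (⇑a.symm ∘ ⇑a) = μ := by
      rw [show ⇑a.symm ∘ ⇑a = id from funext a.symm_apply_apply]
      exact Measure.map_id
    rw [← Measure.map_map a.symm.continuous.measurable a.continuous.measurable, ha] at h1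
    exact h1

/-- Two metric spaces with measures are identified by a measure-preserving isometry (used only for
measures of full support, so that the isometry is between the whole spaces). -/
def MeasurePreservingIsometric {X Y : Type u} [MetricSpace X] [MeasurableSpace X]
    [MetricSpace Y] [MeasurableSpace Y] (μ : Measure X) (ν : Measure Y) : Prop :=
  ∃ ψ : X ≃ᵢ Y, μ.map ψ = ν

/-- A `G`-invariant distance on `G / K` which induces the quotient topology. -/
structure InvariantMetric {G : Type u} [Group G] [TopologicalSpace G] (K : Subgroup G) where
  metric : MetricSpace (G ⧸ K)
  topology_eq : metric.toUniformSpace.toTopologicalSpace =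
    QuotientGroup.instTopologicalSpace K
  dist_smul : ∀ (g : G) (a b : G ⧸ K), metric.dist (g • a) (g • b) = metric.dist a b

/-- The Haar probability measure of a compact group, pushed forward to the Borel σ-algebra of
`G / K` under `g ↦ gK`. -/
noncomputable def quotientHaar {G : Type u} [Group G] [TopologicalSpace G] [IsTopologicalGroup G]
    [CompactSpace G] [MeasurableSpace G] [BorelSpace G] (K : Subgroup G) :
    @Measure (G ⧸ K) (borel (G ⧸ K)) :=
  @Measure.map G (G ⧸ K) _ (borel (G ⧸ K)) (QuotientGroup.mk)
    (Measure.haarMeasure (⊤ : PositiveCompacts G))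

/-- `(X, d, μ)` is, up to measure-preserving isometry, a compact homogeneous space
`(G / K, d_{G/K}, μ_{G/K})`. -/
def IsCompactHomogeneous {X : Type u} [MetricSpace X] [MeasurableSpace X] (μ : Measure X) : Prop :=
  ∃ (G : Type u) (_ : Group G) (_ : TopologicalSpace G) (_ : IsTopologicalGroup G)
    (_ : CompactSpace G) (_ : T2Space G) (_ : MeasurableSpace G) (_ : BorelSpace G)
    (K : Subgroup G) (_ : IsClosed (K : Set G)) (δ : InvariantMetric K),
    @MeasurePreservingIsometric X (G ⧸ K) _ _ δ.metric (borel (G ⧸ K)) μ (quotientHaar K)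

/-! Conditionally on the shared root, the two tails are independent with the same law, so the
covariance in assertion 1 is the variance of `pointedMean μ φ` under `μ`. This function is
continuous and `μ` charges every nonempty open set, so zero variance means constancy; as `p` and `φ`
vary, the pointed means determine the pointed law. This is 1 ↔ 2
(`covariance_eq_variance_pointedMean`, `variance_pointedMean_eq_zero_iff`,
`pointedDistMatrixLaw_eq_iff`).

If the pointed laws at `x` and `y` agree, there are two sequences whose empirical measures tend to
`μ` and whose distance matrices, with `x` and `y` prepended, coincide. Such sequences are dense, so
matching them term by term extends to an isometry sending `x` to `y`, and uniqueness of weak limits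
shows that it preserves `μ` (`exists_isomp_of_pointedDistMatrixLaw_eq`).

Under transitivity all balls of a given radius have the same mass, which forces `X` to be compact
(`compactSpace_of_isomp_transitive`). Then `Isomp μ` is a compact group, `X` is its quotient by a
stabilizer, and `μ` is the image of Haar measure, the only invariant probability measure
(`map_haar_smul_eq`). Conversely, left translations of `G ⧸ K` are transitive isometries preserving
`quotientHaar K`. -/

/-! ### Pointed distance laws and their finite-dimensional observables. -/

section PointedDistanceLaws

variable {X : Type u} [MetricSpace X]

/-- The upper left `p × p` block of an infinite distance matrix. -/
def distBlock (p : ℕ) (D : RMet) : DistIndex p → ℝ :=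
  fun ij => D.1 ⟨((ij.1.1 : ℕ), (ij.1.2 : ℕ)), ij.2⟩

lemma measurable_distBlock (p : ℕ) : Measurable (distBlock p) :=
  measurable_pi_lambda _ fun _ => (measurable_pi_apply _).comp measurable_subtype_coe

lemma continuous_distMatrix : Continuous (distMatrix : (ℕ → X) → RMet) :=
  Continuous.subtype_mk (by fun_prop) _

lemma continuous_distVector {p : ℕ} : Continuous (distVector : (Fin p → X) → DistIndex p → ℝ) := by
  unfold distVector
  fun_prop

lemma continuous_prependPoint : Continuous fun q : X × (ℕ → X) => prependPoint q.1 q.2 := by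
  refine continuous_pi fun n => ?_
  cases n with
  | zero => exact continuous_fst
  | succ n => exact (continuous_apply n).comp continuous_snd

lemma continuous_prependPoint_right (x : X) : Continuous (prependPoint x) :=
  continuous_prependPoint.comp (by fun_prop : Continuous fun s : ℕ → X => (x, s))

/-- The bounded continuous observable `φ(d(x, s₀, …, s_{p-2}))`. -/
def pointedObservable {p : ℕ} (φ : BoundedContinuousFunction (DistIndex p → ℝ) ℝ)
    (q : X × (ℕ → X)) : ℝ :=
  φ (distVector fun i : Fin p => prependPoint q.1 q.2 i)

lemma continuous_pointedObservable {p : ℕ}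
    (φ : BoundedContinuousFunction (DistIndex p → ℝ) ℝ) :
    Continuous (pointedObservable φ : X × (ℕ → X) → ℝ) := by
  refine φ.continuous.comp (continuous_distVector.comp (continuous_pi fun i => ?_))
  exact (continuous_apply (i : ℕ)).comp continuous_prependPoint

lemma norm_pointedObservable_le {p : ℕ} (φ : BoundedContinuousFunction (DistIndex p → ℝ) ℝ)
    (q : X × (ℕ → X)) : ‖pointedObservable φ q‖ ≤ ‖φ‖ :=
  φ.norm_coe_le_norm _

variable [MeasurableSpace X] [BorelSpace X] [SeparableSpace X]
  (μ : Measure X) [IsProbabilityMeasure μ]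

lemma measurable_pointedObservable {p : ℕ}
    (φ : BoundedContinuousFunction (DistIndex p → ℝ) ℝ) :
    Measurable (pointedObservable φ : X × (ℕ → X) → ℝ) := by
  have := UniformSpace.secondCountable_of_separable X
  exact (continuous_pointedObservable φ).measurable

lemma measurable_distMatrix_prependPoint (x : X) :
    Measurable fun s : ℕ → X => distMatrix (prependPoint x s) := by
  have := UniformSpace.secondCountable_of_separable X
  exact (continuous_distMatrix.comp (continuous_prependPoint_right x)).measurable

instance (x : X) : IsProbabilityMeasure (pointedDistMatrixLaw μ x) :=
  Measure.isProbabilityMeasure_map (measurable_distMatrix_prependPoint x).aemeasurable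

/-- The mean of `φ(d(x, X₀, …, X_{p-2}))`. -/
noncomputable def pointedMean {p : ℕ} (φ : BoundedContinuousFunction (DistIndex p → ℝ) ℝ)
    (x : X) : ℝ :=
  ∫ s, pointedObservable φ (x, s) ∂Measure.infinitePi (fun _ : ℕ => μ)

lemma integral_distBlock_pointedDistMatrixLaw {p : ℕ}
    (φ : BoundedContinuousFunction (DistIndex p → ℝ) ℝ) (x : X) :
    ∫ v, φ v ∂(pointedDistMatrixLaw μ x).map (distBlock p) = pointedMean μ φ x := by
  rw [integral_map (measurable_distBlock p).aemeasurable φ.continuous.aestronglyMeasurable,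
    pointedDistMatrixLaw, integral_map (measurable_distMatrix_prependPoint x).aemeasurable
      (f := fun D => φ (distBlock p D))
      (φ.continuous.measurable.comp (measurable_distBlock p)).aestronglyMeasurable]
  rfl

/-- Dominated convergence, with the constant bound `‖φ‖`. Continuity is what later upgrades almost
sure constancy to constancy. -/
lemma continuous_pointedMean {p : ℕ} (φ : BoundedContinuousFunction (DistIndex p → ℝ) ℝ) :
    Continuous (pointedMean μ φ) := by
  refine continuous_of_dominated (bound := fun _ => ‖φ‖) (fun x => ?_) (fun x => ?_)
    (integrable_const _) ?_
  · exact ((measurable_pointedObservable φ).comp measurable_prodMk_left).aestronglyMeasurable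
  · exact Filter.Eventually.of_forall fun s => norm_pointedObservable_le φ _
  · exact Filter.Eventually.of_forall fun s =>
      (continuous_pointedObservable φ).comp (by fun_prop)

lemma memLp_pointedMean {p : ℕ} (φ : BoundedContinuousFunction (DistIndex p → ℝ) ℝ) :
    MemLp (pointedMean μ φ) 2 μ := by
  refine MemLp.of_bound (continuous_pointedMean μ φ).aestronglyMeasurable ‖φ‖
    (Filter.Eventually.of_forall fun x => ?_)
  simpa [pointedMean] using norm_integral_le_of_norm_le_const
    (μ := Measure.infinitePi fun _ : ℕ => μ) (C := ‖φ‖)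
    (Filter.Eventually.of_forall fun s => norm_pointedObservable_le φ (x, s))

/-- Laws of infinite distance matrices are determined by their finite blocks. -/
lemma RMet.measure_ext {ν ν' : Measure RMet} [IsFiniteMeasure ν] [IsFiniteMeasure ν']
    (h : ∀ p, 1 ≤ p → ν.map (distBlock p) = ν'.map (distBlock p)) : ν = ν' := by
  have hval : ν.map Subtype.val = ν'.map Subtype.val := by
    refine IsProjectiveLimit.unique (P := fun I => (ν.map Subtype.val).map I.restrict)
      (fun I => rfl) (fun I => ?_)
    obtain ⟨p, hp⟩ : ∃ p, ∀ ij ∈ I, ij.1.2 < p :=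
      ⟨I.sup (fun ij => ij.1.2) + 1, fun ij hij =>
        Nat.lt_succ_of_le (Finset.le_sup (f := fun ij => ij.1.2) hij)⟩
    -- Finitely many entries lie in one block; size `p + 1` makes the condition `1 ≤ p` of `h`
    -- automatic.
    let r : (DistIndex (p + 1) → ℝ) → (I → ℝ) := fun v ij =>
      v ⟨(⟨ij.1.1.1, ij.1.2.trans ((hp _ ij.2).trans p.lt_succ_self)⟩,
        ⟨ij.1.1.2, (hp _ ij.2).trans p.lt_succ_self⟩), ij.1.2⟩
    have hr : Measurable r := measurable_pi_lambda _ fun _ => measurable_pi_apply _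
    have key : ∀ ρ : Measure RMet, (ρ.map Subtype.val).map I.restrict =
        (ρ.map (distBlock (p + 1))).map r := fun ρ => by
      rw [Measure.map_map (Finset.measurable_restrict I) measurable_subtype_coe,
        Measure.map_map hr (measurable_distBlock _)]
      rfl
    simp only [key, h (p + 1) (Nat.le_add_left _ _)]
  ext A hA
  obtain ⟨B, hB, rfl⟩ := hA
  rw [← Measure.map_apply measurable_subtype_coe hB, hval,
    Measure.map_apply measurable_subtype_coe hB]

lemma pointedDistMatrixLaw_eq_iff (x y : X) :
    pointedDistMatrixLaw μ x = pointedDistMatrixLaw μ y ↔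
      ∀ p : ℕ, 1 ≤ p → ∀ φ : BoundedContinuousFunction (DistIndex p → ℝ) ℝ,
        pointedMean μ φ x = pointedMean μ φ y := by
  constructor
  · intro h p _ φ
    rw [← integral_distBlock_pointedDistMatrixLaw, h, integral_distBlock_pointedDistMatrixLaw]
  · intro h
    refine RMet.measure_ext fun p hp => ?_
    have (z : X) : IsProbabilityMeasure ((pointedDistMatrixLaw μ z).map (distBlock p)) :=
      Measure.isProbabilityMeasure_map (measurable_distBlock p).aemeasurable
    refine ext_of_forall_integral_eq_of_IsFiniteMeasure fun φ => ?_
    simp only [integral_distBlock_pointedDistMatrixLaw, h p hp φ]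

end PointedDistanceLaws

/-! ### Covariance as the variance of a conditional mean. -/

section Covariance

lemma distVector_eq_prependPoint {X Ω : Type*} [MetricSpace X] {Y : ℕ → Ω → X}
    (p : ℕ) (ω : Ω) :
    distVector (fun i : Fin p => Y i ω) =
      distVector fun i : Fin p => prependPoint (Y 0 ω) (fun n => Y (n + 1) ω) i := by
  congr 1
  funext ⟨i, hi⟩
  cases i <;> rfl

lemma distVector_ite_eq_prependPoint {X Ω : Type*} [MetricSpace X] {Y Y' : ℕ → Ω → X}
    (p : ℕ) (ω : Ω) :
    distVector (fun i : Fin p => if (i : ℕ) = 0 then Y 0 ω else Y' i ω) =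
      distVector fun i : Fin p => prependPoint (Y 0 ω) (fun n => Y' (n + 1) ω) i := by
  congr 1
  funext ⟨i, hi⟩
  cases i <;> rfl

lemma comap_pi_le {ι γ Ω E : Type*} [mE : MeasurableSpace E] (Z : ι → Ω → E) (k : γ → ι) :
    MeasurableSpace.comap (fun ω a => Z (k a) ω) MeasurableSpace.pi ≤
      ⨆ i ∈ Set.range k, MeasurableSpace.comap (Z i) mE := by
  rw [MeasurableSpace.pi, MeasurableSpace.comap_iSup]
  refine iSup_le fun a => ?_
  rw [MeasurableSpace.comap_comp]
  exact le_iSup₂_of_le (k a) ⟨a, rfl⟩ le_rfl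

/-- Tuples of an independent family over disjoint sets of indices are independent. -/
lemma ProbabilityTheory.iIndepFun.indepFun_pi_of_disjoint_range {ι α β Ω E : Type*}
    [MeasurableSpace Ω] [MeasurableSpace E] {P : Measure Ω} {Z : ι → Ω → E}
    (hZ : iIndepFun Z P) (hm : ∀ i, Measurable (Z i)) {f : α → ι} {g : β → ι}
    (hfg : ∀ a b, f a ≠ g b) :
    IndepFun (fun ω a => Z (f a) ω) (fun ω b => Z (g b) ω) P := by
  rw [IndepFun_iff_Indep]
  have hd : Disjoint (Set.range f) (Set.range g) := by
    rw [Set.disjoint_left]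
    rintro _ ⟨a, rfl⟩ ⟨b, hb⟩
    exact hfg a b hb.symm
  exact indep_of_indep_of_le_left (indep_of_indep_of_le_right
    (indep_iSup_of_disjoint (fun i => (hm i).comap_le) hZ.iIndep hd) (comap_pi_le Z g)) (comap_pi_le Z f)

lemma map_root_and_tails {X Ω : Type*} [MeasurableSpace X] (μ : Measure X)
    [MeasurableSpace Ω] {P : Measure Ω} [IsProbabilityMeasure P] {Y Y' : ℕ → Ω → X}
    (hY : ∀ n, Measurable (Y n)) (hY' : ∀ n, Measurable (Y' n))
    (lawY : ∀ n, P.map (Y n) = μ) (lawY' : ∀ n, P.map (Y' n) = μ)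
    (hindep : iIndepFun (Sum.elim Y Y') P) :
    P.map (fun ω => (Y 0 ω, (fun n => Y (n + 1) ω), fun n => Y' (n + 1) ω)) =
      μ.prod ((Measure.infinitePi fun _ : ℕ => μ).prod (Measure.infinitePi fun _ : ℕ => μ)) := by
  have hm : ∀ i, Measurable (Sum.elim Y Y' i) := by
    rintro (i | i)
    exacts [hY i, hY' i]
  have hB : P.map (fun ω n => Y (n + 1) ω) = Measure.infinitePi fun _ : ℕ => μ := by
    have h := hindep.precomp (g := fun n : ℕ => Sum.inl (n + 1)) (fun a b h => by simpa using h)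
    simpa [lawY] using h.map_fun_eq_infinitePi_map (fun n => hY (n + 1))
  have hC : P.map (fun ω n => Y' (n + 1) ω) = Measure.infinitePi fun _ : ℕ => μ := by
    have h := hindep.precomp (g := fun n : ℕ => Sum.inr (n + 1)) (fun a b h => by simpa using h)
    simpa [lawY'] using h.map_fun_eq_infinitePi_map (fun n => hY' (n + 1))
  have hBC : IndepFun (fun ω n => Y (n + 1) ω) (fun ω n => Y' (n + 1) ω) P :=
    hindep.indepFun_pi_of_disjoint_range hm (f := fun n : ℕ => Sum.inl (n + 1))
      (g := fun n : ℕ => Sum.inr (n + 1)) (by simp)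
  have hA : IndepFun (Y 0) (fun ω => ((fun n => Y (n + 1) ω), fun n => Y' (n + 1) ω)) P := by
    -- The root is treated as a tuple indexed by `Unit`, the two tails together as one tuple indexed
    -- by `ℕ ⊕ ℕ`.
    have h := hindep.indepFun_pi_of_disjoint_range hm (f := fun _ : Unit => Sum.inl 0)
      (g := Sum.map (fun n : ℕ => n + 1) (fun n : ℕ => n + 1)) (by rintro _ (b | b) <;> simp)
    exact h.comp (φ := fun v : Unit → X => v ())
      (ψ := fun v : ℕ ⊕ ℕ → X => ((fun n => v (Sum.inl n)), fun n => v (Sum.inr n)))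
      (measurable_pi_apply ()) (by fun_prop)
  rw [hA.map_prod_eq_prod_map_map (hY 0).aemeasurable (by fun_prop),
    hBC.map_prod_eq_prod_map_map (by fun_prop) (by fun_prop), lawY, hB, hC]

variable {X : Type u} [MetricSpace X] [SeparableSpace X]
    [MeasurableSpace X] [BorelSpace X] (μ : Measure X) [IsProbabilityMeasure μ]
    {Ω : Type*} [MeasurableSpace Ω] {P : Measure Ω} [IsProbabilityMeasure P]
    {Y Y' : ℕ → Ω → X}

/-- The covariance of two observations sharing the root is the variance of the pointed mean. -/
lemma covariance_eq_variance_pointedMean (hY : ∀ n, Measurable (Y n))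
    (hY' : ∀ n, Measurable (Y' n))
    (lawY : ∀ n, P.map (Y n) = μ) (lawY' : ∀ n, P.map (Y' n) = μ)
    (hindep : iIndepFun (Sum.elim Y Y') P) {p : ℕ}
    (φ : BoundedContinuousFunction (DistIndex p → ℝ) ℝ) :
    covariance
      (fun ω => φ (distVector (fun i : Fin p => Y i ω)))
      (fun ω => φ (distVector (fun i : Fin p => if (i : ℕ) = 0 then Y 0 ω else Y' i ω))) P =
    variance (pointedMean μ φ) μ := by
  have hlaw := map_root_and_tails μ hY hY' lawY lawY' hindep
  set π : Measure (ℕ → X) := Measure.infinitePi fun _ : ℕ => μ with hπ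
  set W : Ω → X × (ℕ → X) × (ℕ → X) :=
    fun ω => (Y 0 ω, (fun n => Y (n + 1) ω), fun n => Y' (n + 1) ω) with hW
  have hWm : Measurable W := by fun_prop
  have hφ := measurable_pointedObservable (X := X) φ
  have hφ₁ : Measurable fun q : X × (ℕ → X) × (ℕ → X) => pointedObservable φ (q.1, q.2.1) :=
    hφ.comp (by fun_prop)
  have hφ₂ : Measurable fun q : X × (ℕ → X) × (ℕ → X) => pointedObservable φ (q.1, q.2.2) :=
    hφ.comp (by fun_prop)
  have e₁ : (fun ω => φ (distVector (fun i : Fin p => Y i ω))) =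
      fun ω => pointedObservable φ ((W ω).1, (W ω).2.1) := by
    funext ω
    rw [distVector_eq_prependPoint]
    rfl
  have e₂ : (fun ω => φ (distVector (fun i : Fin p => if (i : ℕ) = 0 then Y 0 ω else Y' i ω))) =
      fun ω => pointedObservable φ ((W ω).1, (W ω).2.2) := by
    funext ω
    rw [distVector_ite_eq_prependPoint]
    rfl
  have hb (ν : Measure (X × (ℕ → X) × (ℕ → X))) [IsFiniteMeasure ν]
      {f : X × (ℕ → X) × (ℕ → X) → ℝ} (hf : Measurable f) (C : ℝ) (hC : ∀ q, ‖f q‖ ≤ C) :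
      Integrable f ν :=
    Integrable.of_bound hf.aestronglyMeasurable C (Filter.Eventually.of_forall hC)
  have hprod : ∫ ω, pointedObservable φ ((W ω).1, (W ω).2.1) *
      pointedObservable φ ((W ω).1, (W ω).2.2) ∂P = ∫ x, pointedMean μ φ x ^ 2 ∂μ := by
    rw [← integral_map (φ := W) (f := fun q => pointedObservable φ (q.1, q.2.1) *
      pointedObservable φ (q.1, q.2.2)) hWm.aemeasurable (hφ₁.mul hφ₂).aestronglyMeasurable,
      hlaw, integral_prod (fun q => pointedObservable φ (q.1, q.2.1) *
      pointedObservable φ (q.1, q.2.2)) (hb _ (hφ₁.mul hφ₂) (‖φ‖ * ‖φ‖) fun q => ?_)]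
    · refine integral_congr_ae (Filter.Eventually.of_forall fun x => ?_)
      simp only
      -- With the root fixed at `x`, the two tails are independent, so the integral factors into a
      -- square.
      rw [integral_prod_mul (fun s => pointedObservable φ (x, s))
        (fun s => pointedObservable φ (x, s)), pow_two]
      rfl
    · rw [norm_mul]
      gcongr <;> exact norm_pointedObservable_le φ _
  have hmean₁ : ∫ ω, pointedObservable φ ((W ω).1, (W ω).2.1) ∂P =
      ∫ x, pointedMean μ φ x ∂μ := by
    rw [← integral_map (φ := W) (f := fun q => pointedObservable φ (q.1, q.2.1))
      hWm.aemeasurable hφ₁.aestronglyMeasurable,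
      hlaw, integral_prod _ (hb _ hφ₁ ‖φ‖ fun q => norm_pointedObservable_le φ _)]
    refine integral_congr_ae (Filter.Eventually.of_forall fun x => ?_)
    simp only
    rw [integral_fun_fst (μ := π) (ν := π) (fun s => pointedObservable φ (x, s))]
    simp [pointedMean, hπ]
  have hmean₂ : ∫ ω, pointedObservable φ ((W ω).1, (W ω).2.2) ∂P =
      ∫ x, pointedMean μ φ x ∂μ := by
    rw [← integral_map (φ := W) (f := fun q => pointedObservable φ (q.1, q.2.2))
      hWm.aemeasurable hφ₂.aestronglyMeasurable,
      hlaw, integral_prod _ (hb _ hφ₂ ‖φ‖ fun q => norm_pointedObservable_le φ _)]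
    refine integral_congr_ae (Filter.Eventually.of_forall fun x => ?_)
    simp only
    rw [integral_fun_snd (μ := π) (ν := π) (fun s => pointedObservable φ (x, s))]
    simp [pointedMean, hπ]
  have hL₁ : MemLp (fun ω => pointedObservable φ ((W ω).1, (W ω).2.1)) 2 P :=
    MemLp.of_bound (hφ₁.comp hWm).aestronglyMeasurable ‖φ‖
      (Filter.Eventually.of_forall fun ω => norm_pointedObservable_le φ _)
  have hL₂ : MemLp (fun ω => pointedObservable φ ((W ω).1, (W ω).2.2)) 2 P :=
    MemLp.of_bound (hφ₂.comp hWm).aestronglyMeasurable ‖φ‖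
      (Filter.Eventually.of_forall fun ω => norm_pointedObservable_le φ _)
  have hL := memLp_pointedMean μ φ
  rw [e₁, e₂, covariance_eq_sub hL₁ hL₂, variance_eq_sub hL, hmean₁, hmean₂]
  simp only [Pi.mul_apply, Pi.pow_apply]
  rw [hprod, pow_two]

/-- Zero variance gives almost sure equality with the mean; two continuous functions that agree
almost everywhere agree everywhere when nonempty open sets have positive measure. -/
lemma variance_pointedMean_eq_zero_iff [μ.IsOpenPosMeasure] {p : ℕ}
    (φ : BoundedContinuousFunction (DistIndex p → ℝ) ℝ) :
    variance (pointedMean μ φ) μ = 0 ↔ ∀ x y, pointedMean μ φ x = pointedMean μ φ y := by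
  have hc := continuous_pointedMean μ φ
  have hL := memLp_pointedMean μ φ
  constructor
  · intro h x y
    have := (hc.ae_eq_iff_eq μ continuous_const).1 (ae_eq_integral_of_variance_eq_zero hL h)
    rw [this]
  · intro h
    obtain ⟨x⟩ := μ.nonempty_of_neZero
    rw [show pointedMean μ φ = fun _ => pointedMean μ φ x from funext fun y => h y x]
    simp [variance, evariance]

end Covariance

/-! ### Empirical measures and reconstruction from the pointed law. -/

section Reconstruction

open Filter Topology

section Empirical

variable {X : Type u} [MeasurableSpace X]

/-- The empirical measure of the first `n + 1` terms of a sequence. -/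
noncomputable def empiricalMeasure (s : ℕ → X) (n : ℕ) : Measure X :=
  ((n + 1 : ℕ) : ENNReal)⁻¹ • ∑ k ∈ Finset.range (n + 1), Measure.dirac (s k)

instance (s : ℕ → X) (n : ℕ) : IsProbabilityMeasure (empiricalMeasure s n) := ⟨by
  simp only [empiricalMeasure, Measure.smul_apply, Measure.coe_finsetSum, Finset.sum_apply,
    measure_univ, Finset.sum_const, Finset.card_range, nsmul_eq_mul, mul_one, smul_eq_mul]
  exact ENNReal.inv_mul_cancel (by simp) (ENNReal.natCast_ne_top _)⟩

/-- The empirical measure as a probability measure. -/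
noncomputable def empiricalProbability (s : ℕ → X) (n : ℕ) : ProbabilityMeasure X :=
  ⟨empiricalMeasure s n, inferInstance⟩

lemma empiricalMeasure_apply (s : ℕ → X) (n : ℕ) {A : Set X} (hA : MeasurableSet A) :
    (empiricalMeasure s n A).toReal =
      (((n + 1 : ℕ) : ℝ))⁻¹ • ∑ k ∈ Finset.range (n + 1), A.indicator (fun _ => (1 : ℝ)) (s k) := by
  simp only [empiricalMeasure, Measure.smul_apply, Measure.coe_finsetSum, Finset.sum_apply,
    smul_eq_mul, ENNReal.toReal_mul, ENNReal.toReal_inv, ENNReal.toReal_natCast]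
  rw [ENNReal.toReal_sum (fun k _ => measure_ne_top _ _)]
  congr 1
  refine Finset.sum_congr rfl fun k _ => ?_
  rw [Measure.dirac_apply' _ hA]
  by_cases h : s k ∈ A <;> simp [h]

lemma map_empiricalMeasure {f : X → X} (hf : Measurable f) (s : ℕ → X) (n : ℕ) :
    (empiricalMeasure s n).map f = empiricalMeasure (f ∘ s) n := by
  ext A hA
  rw [Measure.map_apply hf hA]
  simp [empiricalMeasure, Measure.dirac_apply' _ hA, Measure.dirac_apply' _ (hf hA),
    Set.indicator]
  rfl

end Empirical

variable {X : Type u} [MetricSpace X]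

/-- Two dense sequences with the same distance matrix are exchanged by an isometry. -/
lemma exists_isometryEquiv_of_dist_eq [CompleteSpace X] {ι : Type*} {u v : ι → X} (hu : DenseRange u)
    (hv : DenseRange v) (huv : ∀ m n, dist (u m) (u n) = dist (v m) (v n)) :
    ∃ i : X ≃ᵢ X, ∀ n, i (u n) = v n := by
  -- Pulling the distance back to the index set makes both `u` and `v` isometries, so `v` extends
  -- along `u`. Only a pseudometric results, since terms may repeat.
  let _ : PseudoMetricSpace ι := PseudoMetricSpace.induced u inferInstance
  have hui : Isometry u := Isometry.of_dist_eq fun _ _ => rfl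
  have hvi : Isometry v := Isometry.of_dist_eq fun m n => (huv m n).symm
  have hd : IsDenseInducing u := hui.isUniformInducing.isDenseInducing hu
  set ψ : X → X := hd.extend v
  have hψc : Continuous ψ :=
    (uniformContinuous_uniformly_extend hui.isUniformInducing hu hvi.uniformContinuous).continuous
  have hψ : ∀ n, ψ (u n) = v n := fun n => hd.extend_eq hvi.continuous n
  have hiso : Isometry ψ := by
    refine Isometry.of_dist_eq fun a b => ?_
    refine hu.induction_on₂ (p := fun a b => dist (ψ a) (ψ b) = dist a b) ?_ ?_ a b
    · exact isClosed_eq (by fun_prop) (by fun_prop)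
    · intro m n
      rw [hψ, hψ, huv]
  have hsurj : Function.Surjective ψ := by
    -- The range is closed because `X` is complete, and it contains the dense range of `v`.
    rw [← Set.range_eq_univ, ← hiso.isClosedEmbedding.isClosed_range.closure_eq]
    refine (hv.mono ?_).closure_eq
    rintro _ ⟨n, rfl⟩
    exact ⟨u n, hψ n⟩
  exact ⟨IsometryEquiv.mk (Equiv.ofBijective ψ ⟨hiso.injective, hsurj⟩) hiso, hψ⟩

variable [MeasurableSpace X] [BorelSpace X] {μ : Measure X} [IsProbabilityMeasure μ]

/-- An open set missed by the sequence has empirical mass zero at every stage, hence `μ`-mass zero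
by the portmanteau inequality for open sets. -/
lemma denseRange_of_tendsto_empiricalProbability [μ.IsOpenPosMeasure] {s : ℕ → X}
    (hs : Tendsto (empiricalProbability s) atTop
      (𝓝 (⟨μ, inferInstance⟩ : ProbabilityMeasure X))) : DenseRange s := by
  refine dense_iff_inter_open.2 fun U hU hne => ?_
  by_contra hcon
  have hout : ∀ k, s k ∉ U := fun k hk => hcon ⟨s k, hk, k, rfl⟩
  have hzero : ∀ n, (empiricalProbability s n : Measure X) U = 0 := by
    intro n
    change empiricalMeasure s n U = 0
    simp [empiricalMeasure, Measure.dirac_apply' _ hU.measurableSet, hout]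
  have h := ProbabilityMeasure.le_liminf_measure_open_of_tendsto hs hU
  simp only [hzero, liminf_const, nonpos_iff_eq_zero] at h
  exact (hU.measure_pos μ hne).ne' h

/-- Pushforward by `f` is weakly continuous and turns the empirical measures of `s` into those of `f
∘ s`, so `μ.map f` and `μ` are limits of the same sequence. -/
lemma map_eq_of_tendsto_empiricalProbability {s : ℕ → X} {f : X → X} (hf : Continuous f)
    (hs : Tendsto (empiricalProbability s) atTop (𝓝 (⟨μ, inferInstance⟩ : ProbabilityMeasure X)))
    (hs' : Tendsto (empiricalProbability (f ∘ s)) atTop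
      (𝓝 (⟨μ, inferInstance⟩ : ProbabilityMeasure X))) : μ.map f = μ := by
  have h := ProbabilityMeasure.tendsto_map_of_tendsto_of_continuous _ _ hs hf
  have heq : (fun n => (empiricalProbability s n).map hf.measurable.aemeasurable) =
      empiricalProbability (f ∘ s) := by
    funext n
    exact Subtype.ext (map_empiricalMeasure hf.measurable s n)
  rw [heq] at h
  exact congrArg ProbabilityMeasure.toMeasure (tendsto_nhds_unique h hs')

variable [SeparableSpace X]

/-- **Varadarajan's theorem**: the empirical measures of an i.i.d. sequence converge weakly to its
law, almost surely. -/
lemma ae_tendsto_empiricalProbability (μ : Measure X) [IsProbabilityMeasure μ] :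
    ∀ᵐ s ∂Measure.infinitePi (fun _ : ℕ => μ),
      Tendsto (empiricalProbability s) atTop (𝓝 (⟨μ, inferInstance⟩ : ProbabilityMeasure X)) := by
  have := UniformSpace.secondCountable_of_separable X
  -- Countability allows one null set to serve for the law of large numbers on every member of `S`;
  -- as a π-system containing a basis, `S` suffices to test weak convergence.
  set S := generateSetAlgebra (countableBasis X)
  have hS : S.Countable := countable_generateSetAlgebra (countable_countableBasis X)
  have hSm : ∀ A ∈ S, MeasurableSet A := by
    intro A hA
    have h := MeasurableSpace.measurableSet_generateFrom hA
    rw [generateFrom_generateSetAlgebra_eq] at h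
    rw [BorelSpace.measurable_eq (α := X), (isBasis_countableBasis X).borel_eq_generateFrom]
    exact h
  have hlln : ∀ A ∈ S, ∀ᵐ s ∂Measure.infinitePi (fun _ : ℕ => μ),
      Tendsto (fun n => (empiricalMeasure s n A).toReal) atTop (𝓝 (μ A).toReal) := by
    intro A hA
    have hg : Measurable (A.indicator fun _ => (1 : ℝ)) :=
      measurable_const.indicator (hSm A hA)
    have hmeas : ∀ n, Measurable fun s : ℕ → X => A.indicator (fun _ => (1 : ℝ)) (s n) :=
      fun n => hg.comp (measurable_pi_apply n)
    have hlaw : ∀ n, (Measure.infinitePi (fun _ : ℕ => μ)).map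
        (fun s => A.indicator (fun _ => (1 : ℝ)) (s n)) = μ.map (A.indicator fun _ => (1 : ℝ)) := by
      intro n
      conv_rhs => rw [← Measure.infinitePi_map_eval (fun _ : ℕ => μ) n,
        Measure.map_map hg (measurable_pi_apply n)]
      rfl
    have h := strong_law_ae (μ := Measure.infinitePi (fun _ : ℕ => μ))
      (fun n s => A.indicator (fun _ => (1 : ℝ)) (s n))
      (Integrable.of_bound (hmeas 0).aestronglyMeasurable 1 (Eventually.of_forall fun s => by
        by_cases hs : s 0 ∈ A <;> simp [hs]))
      (fun m n hmn => (iIndepFun_infinitePi (P := fun _ : ℕ => μ) fun _ => hg).indepFun hmn)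
      (fun n => ⟨(hmeas n).aemeasurable, (hmeas 0).aemeasurable, by rw [hlaw, hlaw]⟩)
    have hmean : ∫ s, A.indicator (fun _ => (1 : ℝ)) (s 0) ∂Measure.infinitePi (fun _ : ℕ => μ) =
        (μ A).toReal := by
      have h0 := integral_map (μ := Measure.infinitePi (fun _ : ℕ => μ))
        (measurable_pi_apply 0).aemeasurable (f := A.indicator fun _ => (1 : ℝ))
        hg.aestronglyMeasurable
      rw [← h0, Measure.infinitePi_map_eval (fun _ : ℕ => μ) 0, integral_indicator (hSm A hA)]
      simp [Measure.real]
    filter_upwards [h] with s hs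
    rw [hmean] at hs
    simp only [empiricalMeasure_apply s _ (hSm A hA)]
    exact hs.comp (tendsto_add_atTop_nat 1)
  filter_upwards [(ae_ball_iff hS).2 hlln] with s hs
  refine IsPiSystem.tendsto_probabilityMeasure_of_tendsto_of_mem (S := S)
    (fun A hA B hB _ => isSetAlgebra_generateSetAlgebra.inter_mem hA hB) hSm ?_ ?_
  · intro U hU x hx
    obtain ⟨B, hB, hxB, hBU⟩ := (isBasis_countableBasis X).exists_subset_of_mem_open hx hU
    exact ⟨B, self_subset_generateSetAlgebra hB,
      ((isBasis_countableBasis X).isOpen hB).mem_nhds hxB, hBU⟩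
  · intro A hA
    rw [← NNReal.tendsto_coe]
    exact hs A hA

lemma pointedDistMatrixLaw_isomp_apply {i : X ≃ᵢ X} (hi : i ∈ Isomp μ) (x : X) :
    pointedDistMatrixLaw μ (i x) = pointedDistMatrixLaw μ x := by
  have hi' : μ.map i = μ := hi
  have hm : Measurable i := i.continuous.measurable
  have hmap := Measure.infinitePi_map_pi (fun _ : ℕ => μ) (fun _ => hm)
  simp only [hi'] at hmap
  rw [pointedDistMatrixLaw, ← hmap,
    Measure.map_map (measurable_distMatrix_prependPoint _) (by fun_prop), pointedDistMatrixLaw]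
  congr 1
  funext s
  have hpre : prependPoint (i x) (fun n => i (s n)) = fun n => i (prependPoint x s n) := by
    funext n
    cases n <;> rfl
  simp only [Function.comp_apply, hpre]
  exact Subtype.ext (funext fun ij => i.dist_eq _ _)

variable [CompleteSpace X]

/-- Sequences with almost sure properties realise the same distance matrix as soon as the pointed
distance matrix laws agree: otherwise disjoint analytic sets would be separated by a Borel set. -/
lemma exists_distMatrix_eq {x y : X}
    (h : pointedDistMatrixLaw μ x = pointedDistMatrixLaw μ y) {p : (ℕ → X) → Prop}
    (hp : ∀ᵐ s ∂Measure.infinitePi (fun _ : ℕ => μ), p s) :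
    ∃ s s', p s ∧ p s' ∧ distMatrix (prependPoint x s) = distMatrix (prependPoint y s') := by
  have := UniformSpace.secondCountable_of_separable X
  -- The event is shrunk to a Borel set of full measure, so that its images are analytic.
  obtain ⟨t, htp, htm, ht⟩ : ∃ t ⊆ {s | p s}, MeasurableSet t ∧
      Measure.infinitePi (fun _ : ℕ => μ) tᶜ = 0 := by
    obtain ⟨n, hn, hnm, hn0⟩ := exists_measurable_superset_of_null (ae_iff.1 hp)
    refine ⟨nᶜ, fun s hs => ?_, hnm.compl, by simpa using hn0⟩
    by_contra hs'
    exact hs (hn hs')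
  have hx := measurable_distMatrix_prependPoint x
  have hy := measurable_distMatrix_prependPoint y
  have : SecondCountableTopology RMet := Topology.IsEmbedding.subtypeVal.secondCountableTopology
  by_contra! hcon
  have hdisj : Disjoint ((fun s => distMatrix (prependPoint x s)) '' t)
      ((fun s => distMatrix (prependPoint y s)) '' t) := by
    rw [Set.disjoint_left]
    rintro _ ⟨s, hs, rfl⟩ ⟨s', hs', heq⟩
    exact hcon s s' (htp hs) (htp hs') heq.symm
  obtain ⟨B, hB₁, hB₂, hBm⟩ :=
    (htm.analyticSet_image hx).measurablySeparable (htm.analyticSet_image hy) hdisj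
  have h₁ : pointedDistMatrixLaw μ x Bᶜ = 0 := by
    rw [pointedDistMatrixLaw, Measure.map_apply hx hBm.compl]
    exact measure_mono_null (fun s hs hst => hs (hB₁ ⟨s, hst, rfl⟩)) ht
  have h₂ : pointedDistMatrixLaw μ x B = 0 := by
    rw [h, pointedDistMatrixLaw, Measure.map_apply hy hBm]
    exact measure_mono_null
      (fun s hs hst => Set.disjoint_left.1 hB₂ ⟨s, hst, rfl⟩ hs) ht
  have h₃ : pointedDistMatrixLaw μ x Set.univ = 0 := by
    rw [← Set.union_compl_self B]
    exact measure_union_null h₂ h₁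
  simp at h₃

/-- The pointed **Gromov–Vershik reconstruction theorem**. -/
theorem exists_isomp_of_pointedDistMatrixLaw_eq [μ.IsOpenPosMeasure] {x y : X}
    (h : pointedDistMatrixLaw μ x = pointedDistMatrixLaw μ y) : ∃ i ∈ Isomp μ, i x = y := by
  obtain ⟨s, s', hs, hs', heq⟩ := exists_distMatrix_eq h (ae_tendsto_empiricalProbability μ)
  have hdense : ∀ {z : X} {r : ℕ → X}, DenseRange r → DenseRange (prependPoint z r) :=
    fun {z r} hr => hr.mono (by rintro _ ⟨n, rfl⟩; exact ⟨n + 1, rfl⟩)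
  have hlt : ∀ m n, m < n → dist (prependPoint x s m) (prependPoint x s n) =
      dist (prependPoint y s' m) (prependPoint y s' n) := fun m n hmn =>
    congrFun (congrArg Subtype.val heq) ⟨(m, n), hmn⟩
  obtain ⟨i, hi⟩ := exists_isometryEquiv_of_dist_eq
    (hdense (denseRange_of_tendsto_empiricalProbability hs))
    (hdense (denseRange_of_tendsto_empiricalProbability hs')) (fun m n => by
      rcases lt_trichotomy m n with hmn | rfl | hmn
      · exact hlt m n hmn
      · simp
      · rw [dist_comm, hlt n m hmn, dist_comm])
  have his : ⇑i ∘ s = s' := funext fun n => hi (n + 1)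
  exact ⟨i, map_eq_of_tendsto_empiricalProbability i.continuous hs (his ▸ hs'), hi 0⟩

end Reconstruction

/-! ### Transitivity forces compactness. -/

section Compactness

variable {X : Type u} [MetricSpace X] [CompleteSpace X] [MeasurableSpace X] [BorelSpace X]
  {μ : Measure X} [IsProbabilityMeasure μ] [μ.IsOpenPosMeasure]

/-- A complete homogeneous metric probability space is compact: balls of a given radius all have
the same positive measure. -/
lemma compactSpace_of_isomp_transitive (h : ∀ x y : X, ∃ i ∈ Isomp μ, i x = y) :
    CompactSpace X := by
  obtain ⟨x₀⟩ := μ.nonempty_of_neZero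
  have hball : ∀ (r : ℝ) (x : X), μ (Metric.ball x r) = μ (Metric.ball x₀ r) := by
    intro r x
    obtain ⟨i, hi, rfl⟩ := h x₀ x
    have hi' : μ.map i = μ := hi
    conv_lhs => rw [← hi']
    rw [Measure.map_apply i.continuous.measurable Metric.isOpen_ball.measurableSet,
      i.preimage_ball, i.symm_apply_apply]
  refine ⟨(Metric.totallyBounded_iff.2 fun ε hε => ?_).isCompact_of_isClosed isClosed_univ⟩
  by_contra! hcon
  have : Std.Symm fun x y : X => ε ≤ dist x y := ⟨fun x y hxy => by rwa [dist_comm]⟩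
  -- Without a finite `ε`-net, greedy choice gives an infinite `ε`-separated sequence; the balls of
  -- radius `ε / 2` about it are disjoint and of equal positive mass, impossible for a finite
  -- measure.
  obtain ⟨f, -, hf⟩ := exists_seq_of_forall_finset_exists' (fun _ : X => True)
    (fun x y : X => ε ≤ dist x y) (fun s _ => by
      have hs := hcon (s : Set X) s.finite_toSet
      rw [Set.not_subset] at hs
      obtain ⟨y, -, hy⟩ := hs
      refine ⟨y, trivial, fun x hx => ?_⟩
      by_contra! hlt
      exact hy (Set.mem_iUnion₂.2 ⟨x, hx, by rwa [Metric.mem_ball, dist_comm]⟩))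
  have hfin := Measure.finite_const_le_meas_of_disjoint_iUnion μ
    (Metric.measure_ball_pos μ x₀ (half_pos hε)) (As := fun n => Metric.ball (f n) (ε / 2))
    (fun n => Metric.isOpen_ball.measurableSet)
    (fun m n hmn => Metric.ball_disjoint_ball (by rw [add_halves]; exact hf hmn))
    (measure_ne_top _ _)
  refine Set.infinite_univ (hfin.subset fun n _ => ?_)
  exact (hball _ _).ge

end Compactness

/-! ### The compact topological group of measure-preserving isometries. -/

section IsompGroup

open Topology

variable {X : Type u} [MetricSpace X]

/-- Pointwise convergent isometries act jointly continuously. -/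
lemma continuous_eval_of_isometry {A : Type*} [TopologicalSpace A] {f : A → X → X}
    (hf : ∀ a, Isometry (f a)) (hc : ∀ x, Continuous fun a => f a x) :
    Continuous fun q : A × X => f q.1 q.2 := by
  refine continuous_iff_continuousAt.2 fun ⟨a, x⟩ => tendsto_iff_dist_tendsto_zero.2 ?_
  have hlim : Filter.Tendsto (fun q : A × X => dist q.2 x + dist (f q.1 x) (f a x)) (𝓝 (a, x))
      (𝓝 0) := by
    have hcont : Continuous fun q : A × X => dist q.2 x + dist (f q.1 x) (f a x) :=
      (continuous_snd.dist continuous_const).add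
        (((hc x).comp continuous_fst).dist continuous_const)
    simpa using hcont.tendsto (a, x)
  refine squeeze_zero (fun _ => dist_nonneg) (fun q => ?_) hlim
  rw [← (hf q.1).dist_eq q.2 x]
  exact dist_triangle _ _ _

/-- Pairs consisting of an isometry and its inverse. -/
def inversePairs (X : Type u) [MetricSpace X] : Set ((X → X) × (X → X)) :=
  {q | ∀ x y, dist (q.1 x) (q.1 y) = dist x y ∧ dist (q.2 x) y = dist x (q.1 y)}

/-- The inverse relation is encoded by distances between values at fixed points, each continuous for
pointwise convergence; composition of arbitrary maps would not be. -/
lemma isClosed_inversePairs : IsClosed (inversePairs X) := by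
  simp only [inversePairs, Set.ofPred_forall, Set.ofPred_and]
  refine isClosed_iInter fun x => isClosed_iInter fun y => IsClosed.inter ?_ ?_
  · exact isClosed_eq (by fun_prop) (by fun_prop)
  · exact isClosed_eq (by fun_prop) (by fun_prop)

/-- The isometry defined by an inverse pair. -/
def isometryEquivOfInversePair {q : (X → X) × (X → X)} (hq : q ∈ inversePairs X) : X ≃ᵢ X where
  toFun := q.1
  invFun := q.2
  left_inv x := dist_eq_zero.1 (by rw [(hq _ _).2, dist_self])
  right_inv x := dist_eq_zero.1 (by rw [dist_comm, ← (hq _ _).2, dist_self])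
  isometry_toFun := Isometry.of_dist_eq fun x y => (hq x y).1

variable [MeasurableSpace X] [BorelSpace X] {μ : Measure X}

namespace Isomp

instance : MulAction (Isomp μ) X where
  smul g x := (g : X ≃ᵢ X) x
  one_smul _ := rfl
  mul_smul _ _ _ := rfl

instance : IsIsometricSMul (Isomp μ) X := ⟨fun g => (g : X ≃ᵢ X).isometry⟩

variable (μ) in
/-- An isometry, recorded together with its inverse as a pair of maps. -/
def toPair (g : Isomp μ) : (X → X) × (X → X) := (fun x => g • x, fun x => g⁻¹ • x)

/-- The topology of pointwise convergence of isometries and of their inverses. -/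
instance : TopologicalSpace (Isomp μ) := TopologicalSpace.induced (toPair μ) inferInstance

lemma isInducing_toPair : IsInducing (toPair μ) := ⟨rfl⟩

lemma toPair_injective : Function.Injective (toPair μ) := fun _ _ h =>
  Subtype.ext (IsometryEquiv.ext fun x => congrFun (congrArg Prod.fst h) x)

lemma continuous_iff {A : Type*} [TopologicalSpace A] {f : A → Isomp μ} :
    Continuous f ↔ ∀ x : X, (Continuous fun a => f a • x) ∧ Continuous fun a => (f a)⁻¹ • x := by
  rw [isInducing_toPair.continuous_iff, continuous_prodMk, continuous_pi_iff, continuous_pi_iff,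
    forall_and]
  rfl

instance : ContinuousSMul (Isomp μ) X :=
  ⟨continuous_eval_of_isometry (f := fun (g : Isomp μ) x => g • x)
    (fun g => (g : X ≃ᵢ X).isometry) fun x => ((continuous_iff (f := id)).1 continuous_id x).1⟩

instance : ContinuousInv (Isomp μ) := ⟨continuous_iff.2 fun x => by
  have h := (continuous_iff (f := (id : Isomp μ → Isomp μ))).1 continuous_id x
  exact ⟨h.2, by simpa using h.1⟩⟩

instance : ContinuousMul (Isomp μ) := ⟨continuous_iff.2 fun x => by
  simp only [mul_inv_rev, mul_smul]
  constructor
  · fun_prop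
  · fun_prop⟩

instance : IsTopologicalGroup (Isomp μ) where

instance : T2Space (Isomp μ) :=
  (IsEmbedding.mk isInducing_toPair toPair_injective).t2Space

/-- Pointwise convergence of nets does not allow dominated convergence; integrals are instead
controlled through the uniform norm. -/
lemma lipschitzWith_integral [IsProbabilityMeasure μ] [CompactSpace X] :
    LipschitzWith 1 fun f : C(X, ℝ) => ∫ x, f x ∂μ := by
  refine LipschitzWith.of_dist_le_mul fun f g => ?_
  have hint : ∀ f : C(X, ℝ), Integrable f μ := fun f =>
    Integrable.of_bound f.continuous.aestronglyMeasurable ‖f‖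
      (Filter.Eventually.of_forall f.norm_coe_le_norm)
  rw [dist_eq_norm, ← integral_sub (hint f) (hint g), dist_eq_norm]
  simpa using norm_integral_le_of_norm_le_const (μ := μ) (C := ‖f - g‖)
    (Filter.Eventually.of_forall (f - g).norm_coe_le_norm)

/-- Expresses preservation of `μ` through integrals of continuous functions, a form in which
closedness can be checked. -/
lemma range_toPair [IsProbabilityMeasure μ] [CompactSpace X] :
    Set.range (toPair μ) = Subtype.val '' {q : inversePairs X |
      ∀ φ : C(X, ℝ), ∫ x, φ (q.1.1 x) ∂μ = ∫ x, φ x ∂μ} := by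
  ext q
  constructor
  · rintro ⟨g, rfl⟩
    have hg : μ.map (g : X ≃ᵢ X) = μ := g.2
    refine ⟨⟨toPair μ g, fun x y => ⟨dist_smul g x y, ?_⟩⟩, fun φ => ?_, rfl⟩
    · change dist (g⁻¹ • x) y = dist x (g • y)
      rw [← dist_smul g, smul_inv_smul]
    · conv_rhs => rw [← hg]
      rw [integral_map (g : X ≃ᵢ X).continuous.measurable.aemeasurable
        φ.continuous.aestronglyMeasurable]
      rfl
  · rintro ⟨⟨q, hq⟩, hφ, rfl⟩
    set i := isometryEquivOfInversePair hq
    have hi : i ∈ Isomp μ := by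
      change μ.map i = μ
      have := Measure.isProbabilityMeasure_map (μ := μ) i.continuous.measurable.aemeasurable
      refine ext_of_forall_integral_eq_of_IsFiniteMeasure fun φ => ?_
      rw [integral_map i.continuous.measurable.aemeasurable
        φ.continuous.aestronglyMeasurable]
      exact hφ φ.toContinuousMap
    exact ⟨⟨i, hi⟩, rfl⟩

instance [IsProbabilityMeasure μ] [CompactSpace X] : CompactSpace (Isomp μ) := by
  refine IsClosedEmbedding.compactSpace (f := toPair μ)
    ⟨⟨isInducing_toPair, toPair_injective⟩, ?_⟩
  rw [range_toPair]
  refine isClosed_inversePairs.isClosedEmbedding_subtypeVal.isClosedMap _ ?_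
  rw [Set.ofPred_forall]
  refine isClosed_iInter fun φ => isClosed_eq ?_ continuous_const
  have hev : Continuous fun r : inversePairs X × X => φ (r.1.1.1 r.2) :=
    φ.continuous.comp (continuous_eval_of_isometry
      (f := fun (q : inversePairs X) x => q.1.1 x)
      (fun q => Isometry.of_dist_eq fun x y => (q.2 x y).1) fun x => by fun_prop)
  -- Joint continuity curries to a continuous map into `C(X, ℝ)`, on which integration is
  -- continuous. The ambient product is compact by Tychonoff.
  exact lipschitzWith_integral.continuous.comp (ContinuousMap.curry ⟨_, hev⟩).continuous

end Isomp

end IsompGroup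

/-! ### Compact homogeneous spaces and uniqueness of the invariant measure. -/

section Homogeneous

variable {X : Type u} [MetricSpace X] [MeasurableSpace X] [BorelSpace X]

section Uniqueness

variable {G : Type*} [Group G] [TopologicalSpace G] [IsTopologicalGroup G] [CompactSpace G]
  [MeasurableSpace G] [BorelSpace G]

instance : IsProbabilityMeasure (Measure.haarMeasure (⊤ : PositiveCompacts G)) :=
  ⟨by simpa using Measure.haarMeasure_self (K₀ := (⊤ : PositiveCompacts G))⟩

variable [SeparableSpace X] [MulAction G X] [ContinuousSMul G X] [MulAction.IsPretransitive G X]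

/-- An invariant probability measure on a homogeneous space of a compact group is the law of
`g⁻¹ • x₀` for `g` Haar distributed. -/
lemma eq_map_haar_inv_smul {m : Measure X} [IsProbabilityMeasure m]
    (hm : ∀ g : G, m.map (g • ·) = m) (x₀ : X) :
    m = (Measure.haarMeasure (⊤ : PositiveCompacts G)).map (fun g : G => g⁻¹ • x₀) := by
  have := UniformSpace.secondCountable_of_separable X
  set η := Measure.haarMeasure (⊤ : PositiveCompacts G)
  have hact : Measurable fun q : G × X => q.1⁻¹ • q.2 :=
    (by fun_prop : Continuous fun q : G × X => q.1⁻¹ • q.2).measurable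
  ext A hA
  have hf : Measurable (A.indicator (1 : X → ENNReal)) := measurable_one.indicator hA
  have hconst : ∀ x : X, ∫⁻ g, A.indicator 1 (g⁻¹ • x) ∂η =
      ∫⁻ g, A.indicator 1 (g⁻¹ • x₀) ∂η := by
    intro x
    obtain ⟨k, rfl⟩ := MulAction.exists_smul_eq G x₀ x
    -- The inverse in `g⁻¹ • x` turns a change of base point into a left translation of `g`, so left
    -- invariance suffices.
    rw [← lintegral_mul_left_eq_self (μ := η)
      (fun g => A.indicator (1 : X → ENNReal) (g⁻¹ • x₀)) k⁻¹]
    simp [mul_smul]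
  have hinv : ∀ g : G, ∫⁻ x, A.indicator (1 : X → ENNReal) (g⁻¹ • x) ∂m = m A := by
    intro g
    rw [← lintegral_map hf (measurable_const_smul g⁻¹), hm, lintegral_indicator_one hA]
  calc m A = ∫⁻ g, ∫⁻ x, A.indicator 1 (g⁻¹ • x) ∂m ∂η := by simp [hinv]
    _ = ∫⁻ x, ∫⁻ g, A.indicator 1 (g⁻¹ • x) ∂η ∂m :=
      lintegral_lintegral_swap (hf.comp hact).aemeasurable
    _ = ∫⁻ g, A.indicator 1 (g⁻¹ • x₀) ∂η := by simp [hconst]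
    _ = η.map (fun g : G => g⁻¹ • x₀) A := by
      have h₀ : Measurable fun g : G => g⁻¹ • x₀ :=
        (by fun_prop : Continuous fun g : G => g⁻¹ • x₀).measurable
      rw [← lintegral_map hf h₀, lintegral_indicator_one hA]

/-- An invariant probability measure on a homogeneous space of a compact group is the law of
`g • x₀` for `g` Haar distributed. -/
lemma map_haar_smul_eq {m : Measure X} [IsProbabilityMeasure m]
    (hm : ∀ g : G, m.map (g • ·) = m) (x₀ : X) :
    (Measure.haarMeasure (⊤ : PositiveCompacts G)).map (fun g : G => g • x₀) = m := by
  have h₀ : Measurable fun g : G => g • x₀ :=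
    (by fun_prop : Continuous fun g : G => g • x₀).measurable
  have := Measure.isProbabilityMeasure_map
    (μ := Measure.haarMeasure (⊤ : PositiveCompacts G)) h₀.aemeasurable
  -- The law of `g • x₀` is itself invariant, so the previous lemma applies to it as well as to `m`;
  -- inversion invariance of Haar measure is not needed.
  rw [eq_map_haar_inv_smul hm x₀]
  refine eq_map_haar_inv_smul (fun k => ?_) x₀
  rw [Measure.map_map (measurable_const_smul k) h₀]
  conv_rhs => rw [← map_mul_left_eq_self (Measure.haarMeasure (⊤ : PositiveCompacts G)) k,
    Measure.map_map h₀ (measurable_const_mul k)]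
  congr 1
  funext g
  simp [mul_smul]

end Uniqueness

/-- A metric probability space with a transitive isometric measure preserving action of a compact
group is a compact homogeneous space. -/
theorem isCompactHomogeneous_of_isPretransitive [SeparableSpace X]
    {μ : Measure X} [IsProbabilityMeasure μ]
    (G : Type u) [Group G] [TopologicalSpace G] [IsTopologicalGroup G] [CompactSpace G] [T2Space G]
    [MulAction G X] [ContinuousSMul G X] [IsIsometricSMul G X] [MulAction.IsPretransitive G X]
    (hinv : ∀ g : G, μ.map (g • ·) = μ) : IsCompactHomogeneous μ := by
  obtain ⟨x₀⟩ := μ.nonempty_of_neZero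
  borelize G
  set K := MulAction.stabilizer G x₀
  set b : G ⧸ K → X := MulAction.ofQuotientStabilizer G x₀
  have hK : IsClosed (K : Set G) :=
    isClosed_eq (by fun_prop : Continuous fun g : G => g • x₀) continuous_const
  have hbi : Function.Injective b := MulAction.injective_ofQuotientStabilizer G x₀
  have hbs : Function.Surjective b := fun x => by
    obtain ⟨g, hg⟩ := MulAction.exists_smul_eq G x₀ x
    exact ⟨QuotientGroup.mk g, hg⟩
  have hbc : Continuous b :=
    QuotientGroup.isOpenQuotientMap_mk.isQuotientMap.continuous_iff.2
      (by fun_prop : Continuous fun g : G => g • x₀)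
  -- A continuous injection from a compact space to a Hausdorff one; hence the metric pulled back
  -- along `b` induces the quotient topology.
  have hbe : Topology.IsClosedEmbedding b := hbc.isClosedEmbedding hbi
  have hb_smul : ∀ (g : G) (q : G ⧸ K), b (g • q) = g • b q :=
    MulAction.ofQuotientStabilizer_smul G x₀
  let δ : InvariantMetric K :=
    { metric := MetricSpace.induced b hbi inferInstance
      topology_eq := hbe.isInducing.eq_induced.symm
      dist_smul := fun g a c => by
        change dist (b (g • a)) (b (g • c)) = dist (b a) (b c)
        rw [hb_smul, hb_smul, dist_smul] }
  let e : X ≃ G ⧸ K := (Equiv.ofBijective b ⟨hbi, hbs⟩).symm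
  have hbe' : ∀ x, b (e x) = x := fun x => (Equiv.ofBijective b ⟨hbi, hbs⟩).apply_symm_apply x
  have heb : ∀ q, e (b q) = q := fun q => (Equiv.ofBijective b ⟨hbi, hbs⟩).symm_apply_apply q
  refine ⟨G, inferInstance, inferInstance, inferInstance, inferInstance, inferInstance,
    inferInstance, inferInstance, K, hK, δ, ?_⟩
  let ψ := @IsometryEquiv.mk X (G ⧸ K) _ δ.metric.toPseudoMetricSpace.toPseudoEMetricSpace e
    (by
      refine @Isometry.of_dist_eq X (G ⧸ K) _ δ.metric.toPseudoMetricSpace e fun x y => ?_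
      change dist (b (e x)) (b (e y)) = dist x y
      rw [hbe', hbe'])
  refine ⟨ψ, ?_⟩
  change @Measure.map X (G ⧸ K) _ (borel (G ⧸ K)) e μ = quotientHaar K
  borelize (G ⧸ K)
  have hem : Measurable e := by
    refine Continuous.measurable (hbe.isInducing.continuous_iff.2 ?_)
    exact continuous_id.congr fun x => (hbe' x).symm
  have hmk : Measurable (QuotientGroup.mk : G → G ⧸ K) :=
    QuotientGroup.continuous_mk.measurable
  have hμ : (quotientHaar K).map b = μ := by
    rw [quotientHaar, Measure.map_map hbc.measurable hmk]
    exact map_haar_smul_eq hinv x₀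
  rw [← hμ, Measure.map_map hem hbc.measurable, show ⇑e ∘ b = id from funext heb, Measure.map_id]

variable {μ : Measure X}

/-- Transitive isometric actions preserving a measure can be transported along isometries. -/
lemma exists_isomp_of_isometryEquiv {Z G : Type*} [MetricSpace Z] [MeasurableSpace Z]
    [BorelSpace Z] [Group G] [MulAction G Z] [IsIsometricSMul G Z] [MulAction.IsPretransitive G Z]
    (ψ : X ≃ᵢ Z) (hinv : ∀ g : G, (μ.map ψ).map (g • ·) = μ.map ψ) (x y : X) :
    ∃ i ∈ Isomp μ, i x = y := by
  obtain ⟨g, hg⟩ := MulAction.exists_smul_eq G (ψ x) (ψ y)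
  refine ⟨(ψ.trans (IsometryEquiv.constSMul g)).trans ψ.symm, ?_, ?_⟩
  · have hψ := ψ.continuous.measurable
    have hψ' := ψ.symm.continuous.measurable
    have hg' : Measurable fun z : Z => g • z := (isometry_smul Z g).continuous.measurable
    have h := congrArg (Measure.map ψ.symm) (hinv g)
    rw [Measure.map_map hg' hψ, Measure.map_map hψ' (hg'.comp hψ), Measure.map_map hψ' hψ,
      show ⇑ψ.symm ∘ ⇑ψ = id from funext ψ.symm_apply_apply, Measure.map_id] at h
    exact h
  · simp [hg]

lemma map_smul_quotientHaar {G : Type u} [Group G] [TopologicalSpace G] [IsTopologicalGroup G]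
    [CompactSpace G] [MeasurableSpace G] [BorelSpace G] (K : Subgroup G) (g : G) :
    @Measure.map _ _ (borel (G ⧸ K)) (borel (G ⧸ K)) (g • ·) (quotientHaar K) =
      quotientHaar K := by
  borelize (G ⧸ K)
  have hmk : Measurable (QuotientGroup.mk : G → G ⧸ K) :=
    QuotientGroup.continuous_mk.measurable
  rw [quotientHaar, Measure.map_map (continuous_const_smul g).measurable hmk]
  conv_rhs => rw [← map_mul_left_eq_self (Measure.haarMeasure (⊤ : PositiveCompacts G)) g,
    Measure.map_map hmk (measurable_const_mul g)]
  rfl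

theorem IsCompactHomogeneous.exists_isomp (h : IsCompactHomogeneous μ) (x y : X) :
    ∃ i ∈ Isomp μ, i x = y := by
  obtain ⟨G, _, _, _, _, _, _, _, K, -, δ, ψ, hψ⟩ := h
  -- The metric topology equals the quotient topology only through `δ.topology_eq`, so the Borel
  -- instance has to be transported.
  have hborel : @BorelSpace (G ⧸ K) δ.metric.toUniformSpace.toTopologicalSpace
      (borel (G ⧸ K)) := by
    rw [δ.topology_eq]
    exact @BorelSpace.mk _ _ (borel (G ⧸ K)) rfl
  have hiso := @IsIsometricSMul.mk G (G ⧸ K) δ.metric.toPseudoMetricSpace.toPseudoEMetricSpace _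
    fun g => @Isometry.of_dist_eq _ _ δ.metric.toPseudoMetricSpace δ.metric.toPseudoMetricSpace _
      (δ.dist_smul g)
  refine @exists_isomp_of_isometryEquiv X _ _ _ μ (G ⧸ K) G δ.metric (borel (G ⧸ K)) hborel _ _
    hiso _ ψ (fun g => ?_) x y
  rw [hψ]
  exact map_smul_quotientHaar K g

end Homogeneous

/-! ### The equivalence of the four assertions. -/

theorem mainTheorem1 {X : Type u} [MetricSpace X] [CompleteSpace X] [SeparableSpace X]
    [MeasurableSpace X] [BorelSpace X] (μ : Measure X) [IsProbabilityMeasure μ]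
    (hsupp : μ.support = Set.univ)
    {Ω : Type*} [MeasurableSpace Ω] (P : Measure Ω) [IsProbabilityMeasure P]
    -- `Y` and `Y'` are independent sequences of independent random points with law `μ`
    (Y Y' : ℕ → Ω → X) (hY : ∀ n, Measurable (Y n)) (hY' : ∀ n, Measurable (Y' n))
    (lawY : ∀ n, P.map (Y n) = μ) (lawY' : ∀ n, P.map (Y' n) = μ)
    (hindep : iIndepFun (Sum.elim Y Y') P) :
    List.TFAE [
      ∀ p : ℕ, 1 ≤ p → ∀ φ : BoundedContinuousFunction (DistIndex p → ℝ) ℝ,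
        covariance
          (fun ω => φ (distVector (fun i : Fin p => Y i ω)))
          (fun ω => φ (distVector (fun i : Fin p => if (i : ℕ) = 0 then Y 0 ω else Y' i ω)))
          P = 0,
      ∀ x y : X, pointedDistMatrixLaw μ x = pointedDistMatrixLaw μ y,
      ∀ x y : X, ∃ i ∈ Isomp μ, i x = y,
      IsCompactHomogeneous μ] := by
  have : μ.IsOpenPosMeasure := ⟨fun U hU ⟨x, hx⟩ => by
    have hmem : x ∈ μ.support := hsupp ▸ Set.mem_univ x
    exact ((Measure.mem_support_iff_forall x).1 hmem U (hU.mem_nhds hx)).ne'⟩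
  tfae_have 1 ↔ 2 := by
    simp only [covariance_eq_variance_pointedMean μ hY hY' lawY lawY' hindep,
      variance_pointedMean_eq_zero_iff, pointedDistMatrixLaw_eq_iff]
    exact ⟨fun h x y p hp φ => h p hp φ x y, fun h p hp φ x y => h x y p hp φ⟩
  tfae_have 2 → 3 := fun h x y => exists_isomp_of_pointedDistMatrixLaw_eq (h x y)
  tfae_have 3 → 2 := by
    intro h x y
    obtain ⟨i, hi, rfl⟩ := h x y
    exact (pointedDistMatrixLaw_isomp_apply hi x).symm
  tfae_have 3 → 4 := by
    intro h
    have := compactSpace_of_isomp_transitive h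
    have : MulAction.IsPretransitive (Isomp μ) X := ⟨fun x y => by
      obtain ⟨i, hi, hxy⟩ := h x y
      exact ⟨⟨i, hi⟩, hxy⟩⟩
    exact isCompactHomogeneous_of_isPretransitive (Isomp μ) fun g => g.2
  tfae_have 4 → 3 := fun h => h.exists_isomp
  tfae_finish
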